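/- Let $D$ and $E$ be (not necessarily unital) C*-algebras and let $\phi : D \to E$ be a *-homomorphism. For a C*-algebra $A$, let $\mathcal I(A)$ be the complete lattice of closed two-sided ideals of $A$, ordered by inclusion (infima are intersections, suprema are norm closures of algebraic sums), and for $a \in A$ let $\mathrm{Ideal}(a)$ be the smallest closed two-sided ideal of $A$ containing $a$. An element $a$ is full in a C*-algebra $B$ if $a\in B$ and $B$ is the only closed two-sided ideal of $B$ that contains $a$. Let $X = \mathrm{Prim}(E)$ be the space of primitive ideals of $E$ (kernels of nonzero irreducible *-representations on Hilbert spaces) with the hull-kernel topology, and let $\mathcal O(X)$ be the complete lattice of its open subsets, ordered by inclusion (the infimum of a family is the interior of its intersection, the supremum is its union). Define order preserving maps $$\Phi_E : \mathcal O(X) \to \mathcal I(E),\quad \Phi_E(G) = \bigcap_{J \in X \setminus G} J, \qquad \Phi_D : \mathcal O(X) \to \mathcal I(D),\quad \Phi_D(G) = \phi^{-1}(\Phi_E(G)),$$ where the empty intersection is $E$. Write $D(U) = \Phi_D(U)$ and $E(U) = \Phi_E(U)$. A *-homomorphism $\psi : D \to E$ is called $X$-equivariant if $\psi(D(U)) \subseteq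 E(U)$ for every $U \in \mathcal O(X)$. It is called $X$-full if for every $d \in D$ there is a smallest $U_d \in \mathcal O(X)$ with $d \in D(U_d)$, and $\psi(d)$ is full in $E(U_d)$. Then: 1. $\Phi_E$ is an order isomorphism of $\mathcal O(X)$ onto $\mathcal I(E)$. 2. $\Phi_D$ preserves infima of arbitrary subsets of $\mathcal O(X)$. If, additionally, $\mathcal O(X)$ is finite, then $\Phi_D$ preserves suprema of nonempty increasing nets in $\mathcal O(X)$. 3. For every $d \in D$ there is a smallest open subset $U_d \subseteq X$ with $d \in D(U_d)$. 4. The *-homomorphism $\phi$ is $X$-equivariant and $X$-full. 5. For every *-homomorphism $\psi : D \to E$, one has $\mathrm{Ideal}(\psi(a)) = \mathrm{Ideal}(\phi(a))$ for all $a \in D$ if and only if $\psi$ is $X$-equivariant and $X$-full (with respect to the same maps $\Phi_D$ and $\Phi_E$, defined from $\phi$). -/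

import Mathlib

open TopologicalSpace

namespace CStarX

universe u v

/-- A closed two-sided ideal of a (not necessarily unital) C*-algebra. -/
structure ClosedIdeal (A : Type u) [NonUnitalCStarAlgebra A] extends Submodule ℂ A where
  mul_mem_left' : ∀ (a : A) {x : A}, x ∈ carrier → a * x ∈ carrier
  mul_mem_right' : ∀ (a : A) {x : A}, x ∈ carrier → x * a ∈ carrier
  isClosed' : IsClosed carrier

namespace ClosedIdeal

variable {A : Type u} [NonUnitalCStarAlgebra A]

instance : SetLike (ClosedIdeal A) A where
  coe I := I.carrier
  coe_injective I J h := by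
    obtain ⟨I, _, _, _⟩ := I
    obtain ⟨J, _, _, _⟩ := J
    have : I = J := SetLike.coe_injective h
    subst this
    rfl

/-- Closed ideals are ordered by inclusion. -/
instance : PartialOrder (ClosedIdeal A) := .ofSetLike (ClosedIdeal A) A

theorem le_iff {I J : ClosedIdeal A} : I ≤ J ↔ ∀ x ∈ I, x ∈ J := Iff.rfl

theorem mem_toSubmodule {I : ClosedIdeal A} {x : A} : x ∈ I.toSubmodule ↔ x ∈ I := Iff.rfl

theorem mul_mem_left (I : ClosedIdeal A) (a : A) {x : A} (hx : x ∈ I) : a * x ∈ I :=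
  I.mul_mem_left' a hx

theorem mul_mem_right (I : ClosedIdeal A) (a : A) {x : A} (hx : x ∈ I) : x * a ∈ I :=
  I.mul_mem_right' a hx

theorem isClosed (I : ClosedIdeal A) : IsClosed (I : Set A) := I.isClosed'

/-- The infimum of a collection of closed ideals is their intersection. -/
instance : InfSet (ClosedIdeal A) where
  sInf S :=
    { carrier := ⋂ I ∈ S, (I : Set A)
      zero_mem' := Set.mem_iInter₂.2 fun I _ => I.toSubmodule.zero_mem
      add_mem' := fun hx hy => Set.mem_iInter₂.2 fun I hI =>
        I.toSubmodule.add_mem (Set.mem_iInter₂.1 hx I hI) (Set.mem_iInter₂.1 hy I hI)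
      smul_mem' := fun c _ hx => Set.mem_iInter₂.2 fun I hI =>
        I.toSubmodule.smul_mem c (Set.mem_iInter₂.1 hx I hI)
      mul_mem_left' := fun a _ hx => Set.mem_iInter₂.2 fun I hI =>
        I.mul_mem_left a (Set.mem_iInter₂.1 hx I hI)
      mul_mem_right' := fun a _ hx => Set.mem_iInter₂.2 fun I hI =>
        I.mul_mem_right a (Set.mem_iInter₂.1 hx I hI)
      isClosed' := isClosed_biInter fun I _ => I.isClosed }

theorem mem_sInf {S : Set (ClosedIdeal A)} {x : A} : x ∈ sInf S ↔ ∀ I ∈ S, x ∈ I :=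
  Set.mem_iInter₂

theorem mul_mem_closure_left (N : Submodule ℂ A) (a : A)
    (h : ∀ x ∈ N, a * x ∈ N) {x : A} (hx : x ∈ N.topologicalClosure) :
    a * x ∈ N.topologicalClosure :=
  map_mem_closure (continuous_const_mul a) hx h

theorem mul_mem_closure_right (N : Submodule ℂ A) (a : A)
    (h : ∀ x ∈ N, x * a ∈ N) {x : A} (hx : x ∈ N.topologicalClosure) :
    x * a ∈ N.topologicalClosure :=
  map_mem_closure (f := fun y => y * a) (continuous_mul_const a) hx h

/-- The supremum of a collection of closed ideals is the norm closure of their algebraic sum. -/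
instance : SupSet (ClosedIdeal A) where
  sSup S :=
    { (⨆ I ∈ S, I.toSubmodule : Submodule ℂ A).topologicalClosure with
      mul_mem_left' := fun a {x} hx => by
        refine mul_mem_closure_left _ a (fun y hy => ?_) hx
        have : (⨆ I ∈ S, I.toSubmodule : Submodule ℂ A) ≤
            (⨆ I ∈ S, I.toSubmodule : Submodule ℂ A).comap (LinearMap.mulLeft ℂ a) :=
          iSup₂_le fun I hI z hz =>
            (le_iSup₂ (f := fun (I : ClosedIdeal A) (_ : I ∈ S) => I.toSubmodule) I hI)
              (I.mul_mem_left a hz)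
        exact this hy
      mul_mem_right' := fun a {x} hx => by
        refine mul_mem_closure_right _ a (fun y hy => ?_) hx
        have : (⨆ I ∈ S, I.toSubmodule : Submodule ℂ A) ≤
            (⨆ I ∈ S, I.toSubmodule : Submodule ℂ A).comap (LinearMap.mulRight ℂ a) :=
          iSup₂_le fun I hI z hz =>
            (le_iSup₂ (f := fun (I : ClosedIdeal A) (_ : I ∈ S) => I.toSubmodule) I hI)
              (I.mul_mem_right a hz)
        exact this hy
      isClosed' := Submodule.isClosed_topologicalClosure _ }

theorem isGLB_sInf (S : Set (ClosedIdeal A)) : IsGLB S (sInf S) :=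
  ⟨fun I hI _ hx => mem_sInf.1 hx I hI, fun _ hJ _ hx => mem_sInf.2 fun _ hI => hJ hI hx⟩

theorem isLUB_sSup (S : Set (ClosedIdeal A)) : IsLUB S (sSup S) := by
  refine ⟨fun I hI x hx => ?_, fun J hJ => ?_⟩
  · exact Submodule.le_topologicalClosure _
      ((le_iSup₂ (f := fun (I : ClosedIdeal A) (_ : I ∈ S) => I.toSubmodule) I hI) hx)
  · have h : (⨆ I ∈ S, I.toSubmodule : Submodule ℂ A) ≤ J.toSubmodule :=
      iSup₂_le fun I hI => hJ hI
    exact Submodule.topologicalClosure_minimal _ h J.isClosed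

/-- The complete lattice of closed two-sided ideals. -/
instance : CompleteLattice (ClosedIdeal A) :=
  { completeLatticeOfInf (ClosedIdeal A) isGLB_sInf with
    sSup := sSup
    isLUB_sSup := isLUB_sSup }

theorem mem_inf {I J : ClosedIdeal A} {x : A} : x ∈ I ⊓ J ↔ x ∈ I ∧ x ∈ J := by
  rw [← sInf_pair, mem_sInf]
  simp

theorem mem_top (x : A) : x ∈ (⊤ : ClosedIdeal A) := by
  rw [← sInf_empty, mem_sInf]
  simp

variable (A) in
/-- The ideal `Ideal(x)`: the smallest closed two-sided ideal containing `x`. -/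
def gen (x : A) : ClosedIdeal A := sInf {I | x ∈ I}

/-- `x` is full in the C*-algebra `I`: it lies in `I`, and the only closed two-sided ideal
of the C*-algebra `I` that contains `x` is `I` itself. -/
def IsFullIn (x : A) (I : ClosedIdeal A) : Prop :=
  x ∈ I ∧ ∀ K : Submodule ℂ A, K ≤ I.toSubmodule → IsClosed (K : Set A) →
    (∀ a ∈ I, ∀ k ∈ K, a * k ∈ K ∧ k * a ∈ K) → x ∈ K → K = I.toSubmodule

/-- Preimage of a closed two-sided ideal under a *-homomorphism. -/
def comap {B : Type v} [NonUnitalCStarAlgebra B] (φ : A →⋆ₙₐ[ℂ] B) (J : ClosedIdeal B) :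
    ClosedIdeal A where
  carrier := φ ⁻¹' J
  zero_mem' := by
    change φ 0 ∈ J
    rw [map_zero]
    exact J.toSubmodule.zero_mem
  add_mem' {x y} hx hy := by
    change φ (x + y) ∈ J
    rw [map_add]
    exact J.toSubmodule.add_mem hx hy
  smul_mem' c {x} hx := by
    change φ (c • x) ∈ J
    rw [map_smul]
    exact J.toSubmodule.smul_mem c hx
  mul_mem_left' a {x} hx := by
    change φ (a * x) ∈ J
    rw [map_mul]
    exact J.mul_mem_left _ hx
  mul_mem_right' a {x} hx := by
    change φ (x * a) ∈ J
    rw [map_mul]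
    exact J.mul_mem_right _ hx
  isClosed' := J.isClosed.preimage
    (AddMonoidHomClass.continuous_of_bound φ 1
      (by simpa only [one_mul] using NonUnitalStarAlgHom.norm_apply_le φ))

end ClosedIdeal

/-- A *-representation on a Hilbert space is (topologically) irreducible: it is nonzero, and
the only closed invariant subspaces are the trivial ones. -/
def IsIrreducibleRep {A : Type u} [NonUnitalCStarAlgebra A] {H : Type v} [NormedAddCommGroup H]
    [InnerProductSpace ℂ H] [CompleteSpace H] (π : A →⋆ₙₐ[ℂ] (H →L[ℂ] H)) : Prop :=
  (∃ a, π a ≠ 0) ∧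
    ∀ K : Submodule ℂ H, IsClosed (K : Set H) → (∀ a, ∀ ξ ∈ K, π a ξ ∈ K) → K = ⊥ ∨ K = ⊤

/-- A primitive ideal is the kernel of an irreducible *-representation. (An irreducible
representation is cyclic, so Hilbert spaces in the universe of the algebra suffice.) -/
def ClosedIdeal.IsPrimitive {A : Type u} [NonUnitalCStarAlgebra A] (P : ClosedIdeal A) : Prop :=
  ∃ (H : Type u) (_ : NormedAddCommGroup H) (_ : InnerProductSpace ℂ H) (_ : CompleteSpace H)
    (π : A →⋆ₙₐ[ℂ] (H →L[ℂ] H)), IsIrreducibleRep π ∧ ∀ x, x ∈ P ↔ π x = 0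

theorem ClosedIdeal.IsPrimitive.exists_notMem {A : Type u} [NonUnitalCStarAlgebra A]
    {P : ClosedIdeal A} (hP : P.IsPrimitive) : ∃ a, a ∉ P := by
  obtain ⟨H, _, _, _, π, ⟨⟨a, ha⟩, -⟩, hker⟩ := hP
  exact ⟨a, fun h => ha ((hker a).1 h)⟩

theorem ClosedIdeal.IsPrimitive.prime {A : Type u} [NonUnitalCStarAlgebra A]
    {P : ClosedIdeal A} (hP : P.IsPrimitive) {I J : ClosedIdeal A} (h : I ⊓ J ≤ P) :
    I ≤ P ∨ J ≤ P := by
  obtain ⟨H, _, _, _, π, ⟨-, hirr⟩, hker⟩ := hP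
  by_contra! hcon
  obtain ⟨hI, hJ⟩ := hcon
  simp only [ClosedIdeal.le_iff, not_forall] at hI hJ
  obtain ⟨x, hx, hxP⟩ := hI
  obtain ⟨y, hy, hyP⟩ := hJ
  -- the closed subspace of the vectors annihilated by `J` is invariant
  let K : Submodule ℂ H := ⨅ z : J, LinearMap.ker (π z : H →ₗ[ℂ] H)
  have hK : ∀ ξ, ξ ∈ K ↔ ∀ z ∈ J, π z ξ = 0 := by
    intro ξ
    simp [K, Submodule.mem_iInf]
  have hKc : IsClosed (K : Set H) := by
    have : (K : Set H) = ⋂ z : J, {ξ | π z ξ = 0} := by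
      ext ξ
      simp [hK]
    rw [this]
    exact isClosed_iInter fun z => isClosed_eq (π z).continuous continuous_const
  have hKi : ∀ a, ∀ ξ ∈ K, π a ξ ∈ K := by
    intro a ξ hξ
    rw [hK] at hξ ⊢
    intro z hz
    have := hξ (z * a) (J.mul_mem_right a hz)
    rwa [map_mul] at this
  rcases hirr K hKc hKi with hbot | htop
  · apply hxP
    rw [hker]
    ext ξ
    have : π x ξ ∈ K := by
      rw [hK]
      intro z hz
      have hzx : z * x ∈ P :=
        ClosedIdeal.le_iff.1 h _
          (ClosedIdeal.mem_inf.2 ⟨I.mul_mem_left z hx, J.mul_mem_right x hz⟩)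
      have h0 := (hker _).1 hzx
      rw [map_mul] at h0
      exact congrArg (fun T : H →L[ℂ] H => T ξ) h0
    rw [hbot] at this
    simpa using this
  · apply hyP
    rw [hker]
    ext ξ
    exact (hK ξ).1 (htop ▸ Submodule.mem_top) y hy

/-- The primitive ideal space `Prim(A)`. -/
def Prim (A : Type u) [NonUnitalCStarAlgebra A] : Type u := {P : ClosedIdeal A // P.IsPrimitive}

namespace Prim

variable {A : Type u} [NonUnitalCStarAlgebra A]

/-- The hull of a closed ideal: the primitive ideals containing it. -/
def hull (I : ClosedIdeal A) : Set (Prim A) := {P | I ≤ P.1}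

theorem mem_hull {I : ClosedIdeal A} {P : Prim A} : P ∈ hull I ↔ I ≤ P.1 := Iff.rfl

/-- The Jacobson (hull-kernel) topology: the closed sets are exactly the hulls. -/
instance : TopologicalSpace (Prim A) :=
  TopologicalSpace.ofClosed (Set.range (hull (A := A)))
    ⟨⊤, Set.eq_empty_iff_forall_notMem.2 fun P hP => by
      obtain ⟨a, ha⟩ := P.2.exists_notMem
      exact ha (mem_hull.1 hP (ClosedIdeal.mem_top a))⟩
    (fun S hS => by
      refine ⟨sSup {I | hull I ∈ S}, ?_⟩
      ext P
      constructor
      · intro hP T hT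
        obtain ⟨I, rfl⟩ := hS hT
        exact mem_hull.2 ((le_sSup (a := I) hT).trans (mem_hull.1 hP))
      · intro hP
        exact mem_hull.2 (sSup_le fun I hI => hP _ hI))
    (by
      rintro _ ⟨I, rfl⟩ _ ⟨J, rfl⟩
      refine ⟨I ⊓ J, ?_⟩
      ext P
      constructor
      · intro hP
        exact P.2.prime hP
      · rintro (hP | hP)
        · exact mem_hull.2 (inf_le_left.trans (mem_hull.1 hP))
        · exact mem_hull.2 (inf_le_right.trans (mem_hull.1 hP)))

end Prim

/-- An action of a topological space `X` on a C*-algebra: an order preserving map from the open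
subsets of `X` to the closed two-sided ideals. -/
abbrev Action (X : Type v) [TopologicalSpace X] (A : Type u) [NonUnitalCStarAlgebra A] :=
  Opens X →o ClosedIdeal A

/-- The action `G ↦ ⋂_{J ∈ Prim(E) \ G} J` of `Prim(E)` on `E` (the empty intersection
being `E`). -/
def primAction (E : Type v) [NonUnitalCStarAlgebra E] : Action (Prim E) E where
  toFun G := sInf {J | ∃ P : Prim E, P ∉ G ∧ J = P.1}
  monotone' _ _ h := sInf_le_sInf fun _ ⟨P, hP, hJ⟩ => ⟨P, fun hPG => hP (h hPG), hJ⟩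

/-- The action `G ↦ φ⁻¹(⋂_{J ∈ Prim(E) \ G} J)` of `Prim(E)` on `D`. -/
def pullbackAction {D : Type u} {E : Type v} [NonUnitalCStarAlgebra D] [NonUnitalCStarAlgebra E]
    (φ : D →⋆ₙₐ[ℂ] E) : Action (Prim E) D where
  toFun G := (primAction E G).comap φ
  monotone' _ _ h _ hx := (primAction E).monotone h hx

section Equivariance

universe w

variable {X : Type w} [TopologicalSpace X] {D : Type u} {E : Type v}
  [NonUnitalCStarAlgebra D] [NonUnitalCStarAlgebra E]

/-- A *-homomorphism between `X`-C*-algebras is `X`-equivariant if it maps `D(U)` into `E(U)`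
for every open `U`. -/
def IsEquivariant (ΦD : Action X D) (ΦE : Action X E) (φ : D →⋆ₙₐ[ℂ] E) : Prop :=
  ∀ U : Opens X, φ '' (ΦD U) ⊆ ΦE U

/-- `U` is the smallest open set with `d ∈ D(U)`. -/
def IsSmallestSupport (ΦD : Action X D) (d : D) (U : Opens X) : Prop :=
  IsLeast {V : Opens X | d ∈ ΦD V} U

/-- A *-homomorphism between `X`-C*-algebras is `X`-full if each `d` has a smallest open `U` with
`d ∈ D(U)`, and `φ d` is full in `E(U)` for that `U`. -/
def IsXFull (ΦD : Action X D) (ΦE : Action X E) (φ : D →⋆ₙₐ[ℂ] E) : Prop :=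
  ∀ d : D, ∃ U : Opens X, IsSmallestSupport ΦD d U ∧ ClosedIdeal.IsFullIn (φ d) (ΦE U)

end Equivariance

end CStarX

/-! Everything rests on one fact: a closed ideal of $E$ is the intersection of the primitive ideals
containing it (`exists_isPrimitive_le_notMem`). Since the closed sets of $\mathrm{Prim}(E)$ are the
hulls, $\Phi_E$ is then an order isomorphism, with inverse $I \mapsto$ complement of the hull of
$I$. Consequently $d \in D(U)$ iff $\Phi_E^{-1}(\mathrm{Ideal}(\phi(d))) \le U$. This gives
preservation of infima, the formula $U_d = \Phi_E^{-1}(\mathrm{Ideal}(\phi(d)))$, and $E(U_d) =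
\mathrm{Ideal}(\phi(d))$. Fullness of $\psi(d)$ in $E(U_d)$ thus means $\mathrm{Ideal}(\psi(d)) =
\mathrm{Ideal}(\phi(d))$, because closed ideals of a closed ideal are ideals of the whole algebra.

To separate $x \notin I$ from $I$ by a primitive ideal, pass to the unitization. Hahn-Banach gives a
state that kills $I$ and is positive on $x^*x$; Krein-Milman replaces it by a pure one, whose GNS
representation is irreducible, kills $I$ and does not kill $x$. No quotient is formed: functional
calculus estimates do the work of approximate units. -/

namespace CStarX
open scoped ComplexOrder InnerProductSpace

/-! ### Functional calculus estimates -/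

section Approximation
universe u
variable {B : Type u} [CStarAlgebra B]

theorem cfc_one_sub_id_mul {a : B} (ha : IsSelfAdjoint a) {g : ℝ → ℝ}
    (hg : ContinuousOn g (spectrum ℝ a)) : cfc (fun t => 1 - t * g t) a = 1 - a * cfc g a := by
  rw [cfc_sub (fun _ => (1 : ℝ)) (fun t => t * g t) a continuousOn_const (continuousOn_id.mul hg),
    cfc_const_one ℝ a, cfc_mul (fun t : ℝ => t) g a continuousOn_id hg, cfc_id' ℝ a]

theorem cfc_mul_mul_self {a : B} {v p : ℝ → ℝ} (hv : ContinuousOn v (spectrum ℝ a))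
    (hp : ContinuousOn p (spectrum ℝ a)) :
    cfc (fun t => v t * p t * v t) a = cfc v a * cfc p a * cfc v a := by
  rw [cfc_mul (fun t => v t * p t) v a (hv.mul hp) hv, cfc_mul v p a hv hp]

/-- With $a = y^*y$ and $c = (a+\delta)^{-1}$ the error is $yv$, $v = \delta(a+\delta)^{-1}$, and
$\|yv\|^2 = \|vav\| \le \sup_{t \ge 0} \delta^2 t/(t+\delta)^2 \le \delta$. -/
theorem exists_norm_sub_mul_star_mul_self_mul_lt (y : B) {ε : ℝ} (hε : 0 < ε) :
    ∃ c : B, ‖y - y * (star y * y * c)‖ < ε := by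
  let _ : PartialOrder B := CStarAlgebra.spectralOrder B
  have _ : StarOrderedRing B := CStarAlgebra.spectralOrderedRing B
  set a := star y * y with ha
  have ha0 : 0 ≤ a := star_mul_self_nonneg y
  have hsa : IsSelfAdjoint a := .of_nonneg ha0
  have hpos : ∀ t ∈ spectrum ℝ a, 0 ≤ t := fun t ht => spectrum_nonneg_of_nonneg ha0 ht
  obtain ⟨δ, hδ, hδε⟩ : ∃ δ : ℝ, 0 < δ ∧ δ < ε ^ 2 := exists_between (by positivity)
  have hne : ∀ t ∈ spectrum ℝ a, t + δ ≠ 0 := fun t ht => by have := hpos t ht; positivity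
  have hc : ContinuousOn (fun t : ℝ => (t + δ)⁻¹) (spectrum ℝ a) :=
    ContinuousOn.inv₀ (by fun_prop) hne
  have hcv : ContinuousOn (fun t : ℝ => 1 - t * (t + δ)⁻¹) (spectrum ℝ a) := by fun_prop
  set c := cfc (fun t : ℝ => (t + δ)⁻¹) a
  set v := cfc (fun t : ℝ => 1 - t * (t + δ)⁻¹) a with hv
  have hvc : v = 1 - a * c :=
    cfc_one_sub_id_mul hsa hc
  have hvs : IsSelfAdjoint v := cfc_predicate _ a
  refine ⟨c, ?_⟩
  have h1 : y - y * (a * c) = y * v := by rw [hvc, mul_sub, mul_one]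
  have h2 : star (y * v) * (y * v) =
      cfc (fun t : ℝ => (1 - t * (t + δ)⁻¹) * t * (1 - t * (t + δ)⁻¹)) a := by
    rw [cfc_mul_mul_self (p := fun t => t) hcv continuousOn_id, cfc_id' ℝ a, star_mul, hvs.star_eq, ← hv]
    simp only [mul_assoc, ha]
  have h3 : ‖y * v‖ * ‖y * v‖ ≤ δ := by
    rw [← CStarRing.norm_star_mul_self, h2]
    refine norm_cfc_le hδ.le fun t ht => ?_
    have h0 := hpos t ht
    have hd : 0 < t + δ := by positivity
    have : (1 - t * (t + δ)⁻¹) * t * (1 - t * (t + δ)⁻¹) = δ * (δ * t / (t + δ) ^ 2) := by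
      field_simp
      ring
    rw [this, Real.norm_of_nonneg (by positivity)]
    refine mul_le_of_le_one_right hδ.le ?_
    rw [div_le_one (by positivity)]
    nlinarith
  rw [h1]
  refine lt_of_pow_lt_pow_left₀ 2 hε.le ?_
  rw [sq]
  exact h3.trans_lt hδε

/-- If `x* x ≤ ε - r` with `r` self-adjoint, then `x` is close to a multiple of `r`. -/
theorem exists_norm_sub_mul_sq_le [PartialOrder B] [StarOrderedRing B] (x r : B)
    (hr : IsSelfAdjoint r) {ε : ℝ} (hε : 0 < ε) (h : star x * x ≤ algebraMap ℝ B ε - r) :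
    ∃ c : B, ‖x - x * (r * c)‖ ^ 2 ≤ 2 * ε := by
  -- As $r$ may have spectrum of both signs, $t/(t^2+\delta)$ stands in for $1/t$. The choice
  -- $\delta = \varepsilon^2$ makes $s = \delta/(t^2+\delta)$ satisfy $s|t| \le \varepsilon$.
  set δ := ε ^ 2 with hδ
  have hδ0 : 0 < δ := by positivity
  have hne : ∀ t : ℝ, t ^ 2 + δ ≠ 0 := fun t => by positivity
  have hc : Continuous (fun t : ℝ => (t ^ 2 + δ)⁻¹) := Continuous.inv₀ (by fun_prop) hne
  have hcc : ContinuousOn (fun t : ℝ => t * (t ^ 2 + δ)⁻¹) (spectrum ℝ r) := by fun_prop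
  have hcv : ContinuousOn (fun t : ℝ => 1 - t * (t * (t ^ 2 + δ)⁻¹)) (spectrum ℝ r) := by
    fun_prop
  set c := cfc (fun t : ℝ => t * (t ^ 2 + δ)⁻¹) r
  set v := cfc (fun t : ℝ => 1 - t * (t * (t ^ 2 + δ)⁻¹)) r with hv
  have hvc : v = 1 - r * c :=
    cfc_one_sub_id_mul hr hcc
  have hvs : IsSelfAdjoint v := cfc_predicate _ r
  refine ⟨c, ?_⟩
  have h1 : x - x * (r * c) = x * v := by rw [hvc, mul_sub, mul_one]
  have h2 : star (x * v) * (x * v) ≤ v * (algebraMap ℝ B ε - r) * v := by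
    have := star_left_conjugate_le_conjugate h v
    rw [hvs.star_eq] at this
    simpa only [star_mul, hvs.star_eq, mul_assoc] using this
  have h3 : v * (algebraMap ℝ B ε - r) * v =
      cfc (fun t : ℝ => (1 - t * (t * (t ^ 2 + δ)⁻¹)) * (ε - t) *
        (1 - t * (t * (t ^ 2 + δ)⁻¹))) r := by
    rw [cfc_mul_mul_self (p := fun t => ε - t) hcv (by fun_prop),
      cfc_sub (fun _ => ε) (fun t => t) r continuousOn_const continuousOn_id, cfc_const ε r,
      cfc_id' ℝ r]
  rw [h1, sq, ← CStarRing.norm_star_mul_self]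
  refine (CStarAlgebra.norm_le_norm_of_nonneg_of_le (star_mul_self_nonneg _) h2).trans ?_
  rw [h3]
  refine norm_cfc_le (by positivity) fun t _ => ?_
  have hd : 0 < t ^ 2 + δ := by positivity
  have : (1 - t * (t * (t ^ 2 + δ)⁻¹)) * (ε - t) * (1 - t * (t * (t ^ 2 + δ)⁻¹)) =
      (δ / (t ^ 2 + δ)) ^ 2 * (ε - t) := by
    have := hne t
    field_simp
    ring
  set s := δ / (t ^ 2 + δ) with hs
  have hs0 : 0 ≤ s := by positivity
  have hs1 : s ≤ 1 := by rw [hs, div_le_one hd]; nlinarith [sq_nonneg t]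
  have hst : s * |t| ≤ ε := by
    rw [hs, div_mul_eq_mul_div, div_le_iff₀ hd, ← sq_abs t, hδ]
    nlinarith [mul_nonneg hε.le (sq_nonneg (|t| - ε)), abs_nonneg t,
      mul_nonneg (mul_nonneg hε.le hε.le) (abs_nonneg t), sq_nonneg (|t|), pow_pos hε 3]
  rw [this, Real.norm_eq_abs, abs_mul, abs_of_nonneg (sq_nonneg s)]
  have h5 : |ε - t| ≤ ε + |t| := (abs_sub ε t).trans_eq (by rw [abs_of_pos hε])
  calc s ^ 2 * |ε - t| ≤ s ^ 2 * (ε + |t|) := by gcongr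
    _ = s * (s * ε + s * |t|) := by ring
    _ ≤ 1 * (1 * ε + ε) := by gcongr
    _ = 2 * ε := by ring

end Approximation

/-! ### Closed ideals and fullness -/

section Ideals
universe u
open ClosedIdeal

variable {A : Type u} [NonUnitalCStarAlgebra A]

theorem inr_mul_eq_inr (z : A) (c : Unitization ℂ A) :
    (z : Unitization ℂ A) * c = ((c.fst • z + z * c.snd : A) : Unitization ℂ A) := by
  ext <;> simp

/-- The factor is $y^*y$ times an element of the unitization, in which $A$ is an ideal; so it lies
in $A$, and in every closed ideal containing $y$. -/
theorem exists_norm_sub_mul_star_mul_self_lt (y : A) {ε : ℝ} (hε : 0 < ε) :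
    ∃ c : A, ‖y - y * c‖ < ε ∧ ∀ I : ClosedIdeal A, y ∈ I → c ∈ I := by
  obtain ⟨c, hc⟩ := exists_norm_sub_mul_star_mul_self_mul_lt (y : Unitization ℂ A) hε
  refine ⟨c.fst • (star y * y) + star y * y * c.snd, ?_, fun I hy => ?_⟩
  · have : (y : Unitization ℂ A) - y * (star (y : Unitization ℂ A) * y * c) =
        ((y - y * (c.fst • (star y * y) + star y * y * c.snd) : A) : Unitization ℂ A) := by
      rw [← Unitization.inr_star, ← Unitization.inr_mul, inr_mul_eq_inr (_ * _), ← Unitization.inr_mul,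
        ← Unitization.inr_sub]
    rwa [this, Unitization.norm_inr] at hc
  · have := I.mul_mem_left (star y) hy
    exact I.toSubmodule.add_mem (I.toSubmodule.smul_mem _ this) (I.mul_mem_right _ this)

/-- $y^*$ is a limit of elements $y^*(yy^*)c$, which lie in $I$ because $yy^*$ does. -/
theorem ClosedIdeal.star_mem (I : ClosedIdeal A) {y : A} (hy : y ∈ I) : star y ∈ I := by
  rw [← SetLike.mem_coe, ← I.isClosed.closure_eq, Metric.mem_closure_iff]
  intro ε hε
  obtain ⟨c, hc⟩ := exists_norm_sub_mul_star_mul_self_mul_lt (star y : Unitization ℂ A) hε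
  refine ⟨c.fst • (star y * (y * star y)) + star y * (y * star y) * c.snd, ?_, ?_⟩
  · have := I.mul_mem_left (star y) (I.mul_mem_right (star y) hy)
    exact I.toSubmodule.add_mem (I.toSubmodule.smul_mem _ this) (I.mul_mem_right _ this)
  · rw [dist_eq_norm, ← Unitization.norm_inr (𝕜 := ℂ)]
    rwa [star_star, ← Unitization.inr_star, ← Unitization.inr_mul, inr_mul_eq_inr (_ * _),
      ← Unitization.inr_mul, ← Unitization.inr_sub, mul_add, mul_smul_comm,
      ← mul_assoc (star y) (y * star y) c.snd] at hc

theorem ClosedIdeal.mem_of_forall_exists_norm_sub_lt (I : ClosedIdeal A) {y : A}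
    (h : ∀ ε > 0, ∃ z ∈ I, ‖y - z‖ < ε) : y ∈ I := by
  rw [← SetLike.mem_coe, ← I.isClosed.closure_eq, Metric.mem_closure_iff]
  simpa only [dist_eq_norm, SetLike.mem_coe] using h

/-- A closed two-sided ideal of a closed two-sided ideal of `A` is an ideal of `A`. -/
theorem mul_mem_of_ideal_of_ideal (I : ClosedIdeal A) (K : Submodule ℂ A)
    (hKI : K ≤ I.toSubmodule) (hK : IsClosed (K : Set A))
    (hmul : ∀ a ∈ I, ∀ k ∈ K, a * k ∈ K ∧ k * a ∈ K) (a : A) {k : A} (hk : k ∈ K) :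
    a * k ∈ K ∧ k * a ∈ K := by
  have hcl : ∀ y, (∀ ε > 0, ∃ z ∈ K, ‖y - z‖ < ε) → y ∈ K := fun y h => by
    rw [← SetLike.mem_coe, ← hK.closure_eq, Metric.mem_closure_iff]
    simpa only [dist_eq_norm, SetLike.mem_coe] using h
  have hkI : k ∈ I := hKI hk
  have hpos : 0 < ‖a‖ + 1 := by positivity
  constructor <;> refine hcl _ fun ε hε => ?_
  -- $k \approx c^*k$ with $c \in I$, so $ak \approx (ac^*)k$, where $ac^* \in I$ may act on $K$.
  · obtain ⟨c, hc, hcI⟩ := exists_norm_sub_mul_star_mul_self_lt (star k) (div_pos hε hpos)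
    refine ⟨a * star c * k, (hmul _ (I.mul_mem_left a (I.star_mem (hcI I (I.star_mem hkI)))) _ hk).1,
      ?_⟩
    have h1 : ‖k - star c * k‖ < ε / (‖a‖ + 1) := by
      rw [← norm_star]; simpa using hc
    calc ‖a * k - a * star c * k‖ = ‖a * (k - star c * k)‖ := by rw [mul_sub, mul_assoc]
      _ ≤ ‖a‖ * ‖k - star c * k‖ := norm_mul_le _ _
      _ ≤ (‖a‖ + 1) * ‖k - star c * k‖ := by gcongr; linarith
      _ < ε := by rwa [lt_div_iff₀' hpos] at h1
  · obtain ⟨c, hc, hcI⟩ := exists_norm_sub_mul_star_mul_self_lt k (div_pos hε hpos)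
    refine ⟨k * (c * a), (hmul _ (I.mul_mem_right a (hcI I hkI)) _ hk).2, ?_⟩
    calc ‖k * a - k * (c * a)‖ = ‖(k - k * c) * a‖ := by rw [sub_mul, mul_assoc]
      _ ≤ ‖k - k * c‖ * ‖a‖ := norm_mul_le _ _
      _ ≤ ‖k - k * c‖ * (‖a‖ + 1) := by gcongr; linarith
      _ < ε := by rwa [lt_div_iff₀ hpos] at hc

theorem mem_gen (x : A) : x ∈ gen A x := mem_sInf.2 fun _ h => h

theorem gen_le_iff {x : A} {I : ClosedIdeal A} : gen A x ≤ I ↔ x ∈ I :=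
  ⟨fun h => h (mem_gen x), fun h => sInf_le h⟩

theorem isFullIn_iff {x : A} {I : ClosedIdeal A} : IsFullIn x I ↔ gen A x = I := by
  constructor
  · rintro ⟨hx, h⟩
    have hle : gen A x ≤ I := gen_le_iff.2 hx
    have := h (gen A x).toSubmodule hle (gen A x).isClosed
      (fun a _ k hk => ⟨(gen A x).mul_mem_left a hk, (gen A x).mul_mem_right a hk⟩) (mem_gen x)
    exact le_antisymm hle fun z hz => by
      rw [← mem_toSubmodule, this]; exact hz
  · rintro rfl
    refine ⟨mem_gen x, fun K hKI hK hmul hxK => le_antisymm hKI ?_⟩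
    let K' : ClosedIdeal A :=
      { K with
        mul_mem_left' := fun a _ hk => (mul_mem_of_ideal_of_ideal _ K hKI hK hmul a hk).1
        mul_mem_right' := fun a _ hk => (mul_mem_of_ideal_of_ideal _ K hKI hK hmul a hk).2
        isClosed' := hK }
    exact (gen_le_iff (I := K')).2 hxK

end Ideals

/-! ### States killing an ideal, and pure states -/

section States
universe u
open ClosedIdeal
variable {B : Type u} [CStarAlgebra B] [PartialOrder B] [StarOrderedRing B]

/-- The Cauchy-Schwarz inequality for positive functionals. -/
theorem norm_apply_sq_le (f : B →ₚ[ℂ] ℂ) (b : B) :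
    ‖f b‖ ^ 2 ≤ ‖f 1‖ * ‖f (star b * b)‖ := by
  have h := norm_inner_le_norm (𝕜 := ℂ) (f.toPreGNS 1) (f.toPreGNS b)
  have h1 := f.preGNS_norm_sq (f.toPreGNS 1)
  have h2 := f.preGNS_norm_sq (f.toPreGNS b)
  rw [f.preGNS_inner_def] at h
  simp only [f.ofPreGNS_toPreGNS, star_one, one_mul] at h h1 h2
  rw [← h1, ← h2, norm_pow, norm_pow, Complex.norm_real, Complex.norm_real, norm_norm, norm_norm,
    ← mul_pow]
  gcongr

theorem norm_apply_le (f : B →ₚ[ℂ] ℂ) (b : B) : ‖f b‖ ≤ ‖f 1‖ * ‖b‖ := by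
  refine le_of_sq_le_sq (a := ‖f b‖) ?_ (by positivity)
  refine (norm_apply_sq_le f b).trans ?_
  have := f.norm_apply_le_of_nonneg (star b * b) (star_mul_self_nonneg b)
  rw [CStarRing.norm_star_mul_self] at this
  calc _ ≤ ‖f 1‖ * (‖f 1‖ * (‖b‖ * ‖b‖)) := by gcongr
    _ = _ := by ring

theorem eq_zero_of_apply_one_eq_zero {f : B →ₚ[ℂ] ℂ} (h : f 1 = 0) (b : B) : f b = 0 := by
  simpa [h] using norm_apply_le f b

/-- If `x ∉ J`, some state kills `J` and is positive on `x* x`. -/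
theorem exists_state_apply_pos (J : ClosedIdeal B) {x : B} (hx : x ∉ J) :
    ∃ f : B →ₚ[ℂ] ℂ, f 1 = 1 ∧ (∀ y ∈ J, f y = 0) ∧ 0 < (f (star x * x)).re := by
  -- A functional with nonnegative real part on this cone is positive, kills the subspace $J$, and
  -- is real on self-adjoint elements.
  let C : Set B := {b | ∃ p y k : B, 0 ≤ p ∧ y ∈ J ∧ IsSelfAdjoint k ∧ b = p + y + Complex.I • k}
  have hC : Convex ℝ C := by
    rintro _ ⟨p, y, k, hp, hy, hk, rfl⟩ _ ⟨p', y', k', hp', hy', hk', rfl⟩ s t hs ht -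
    refine ⟨s • p + t • p', (s : ℂ) • y + (t : ℂ) • y', s • k + t • k',
      add_nonneg (smul_nonneg hs hp) (smul_nonneg ht hp'),
      J.toSubmodule.add_mem (J.toSubmodule.smul_mem _ hy) (J.toSubmodule.smul_mem _ hy'),
      (.add (.smul (.all s) hk) (.smul (.all t) hk')), ?_⟩
    simp only [Complex.coe_smul, smul_add, smul_comm Complex.I]
    abel
  have hxC : -(star x * x) ∉ closure C := by
    intro h
    -- Real parts turn $-x^*x \approx p + y + ik$ into $x^*x \le \varepsilon^2/4 - \mathrm{Re}\,y$
    -- with $\mathrm{Re}\,y \in J$. Then $x$ is close to $x(\mathrm{Re}\,y)c \in J$, with squared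
    -- error at most $\varepsilon^2/2$.
    refine hx (J.mem_of_forall_exists_norm_sub_lt fun ε hε => ?_)
    obtain ⟨_, ⟨p, y, k, hp, hy, hk, rfl⟩, hd⟩ :=
      Metric.mem_closure_iff.1 h (ε ^ 2 / 4) (by positivity)
    set z := p + y + Complex.I • k + star x * x with hz
    have hzn : ‖z‖ < ε ^ 2 / 4 := by
      rw [dist_comm, dist_eq_norm, sub_neg_eq_add] at hd
      exact hd
    have hr : IsSelfAdjoint (realPart y : B) := (realPart y).2
    have hrJ : (realPart y : B) ∈ J := by
      rw [realPart_apply_coe]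
      have := J.toSubmodule.smul_mem ((2⁻¹ : ℝ) : ℂ) (J.toSubmodule.add_mem hy (J.star_mem hy))
      rwa [Complex.coe_smul] at this
    have hre : (realPart z : B) = p + realPart y + star x * x := by
      rw [hz]
      simp only [map_add, AddSubgroup.coe_add, realPart_I_smul, hk.imaginaryPart,
        (IsSelfAdjoint.of_nonneg hp).coe_realPart, (IsSelfAdjoint.star_mul_self x).coe_realPart]
      simp
    have hle : star x * x ≤ algebraMap ℝ B (ε ^ 2 / 4) - realPart y := by
      have h1 : (realPart z : B) ≤ algebraMap ℝ B ‖(realPart z : B)‖ :=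
        (realPart z).2.le_algebraMap_norm_self
      have h2 : algebraMap ℝ B ‖(realPart z : B)‖ ≤ algebraMap ℝ B (ε ^ 2 / 4) :=
        algebraMap_mono B ((realPart.norm_le z).trans hzn.le)
      rw [le_sub_iff_add_le]
      calc star x * x + realPart y ≤ p + realPart y + star x * x := by
            rw [add_comm p, add_assoc, add_comm p, ← add_assoc, add_comm (star x * x)]
            exact le_add_of_nonneg_right hp
        _ ≤ _ := hre ▸ h1.trans h2
    obtain ⟨c, hc⟩ := exists_norm_sub_mul_sq_le x _ hr (by positivity) hle
    refine ⟨_, J.mul_mem_left x (J.mul_mem_right c hrJ), ?_⟩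
    refine lt_of_pow_lt_pow_left₀ 2 hε.le (hc.trans_lt ?_)
    nlinarith [pow_pos hε 2]
  obtain ⟨g, u, hu, hgu⟩ := RCLike.geometric_hahn_banach_point_closed (𝕜 := ℂ) hC.closure
    isClosed_closure hxC
  simp only [RCLike.re_to_complex] at hu hgu
  have h0C : (0 : B) ∈ C := ⟨0, 0, 0, le_rfl, J.toSubmodule.zero_mem, .zero _, by simp⟩
  have hu0 : u < 0 := by simpa using hgu 0 (subset_closure h0C)
  have hcone : ∀ b ∈ C, ∀ s : ℝ, 0 ≤ s → s • b ∈ C := by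
    rintro _ ⟨p, y, k, hp, hy, hk, rfl⟩ s hs
    refine ⟨s • p, (s : ℂ) • y, s • k, smul_nonneg hs hp, J.toSubmodule.smul_mem _ hy,
      .smul (.all s) hk, ?_⟩
    simp only [Complex.coe_smul, smul_add, smul_comm Complex.I]
  have hre : ∀ b ∈ C, 0 ≤ (g b).re := by
    intro b hb
    by_contra! hneg
    -- Scaling $b$ inside the cone brings the real part of $g$ to exactly $u$, against the strict
    -- separation.
    have := hgu _ (subset_closure (hcone b hb (u / (g b).re) (div_nonneg_of_nonpos hu0.le hneg.le)))
    rw [← Complex.coe_smul, map_smul, smul_eq_mul, Complex.re_ofReal_mul,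
      div_mul_cancel₀ _ hneg.ne] at this
    exact this.false
  have hmemJ : ∀ y ∈ J, y ∈ C := fun y hy => ⟨0, y, 0, le_rfl, hy, .zero _, by simp⟩
  have hgJ : ∀ y ∈ J, g y = 0 := by
    have key : ∀ y ∈ J, (g y).re = 0 := fun y hy => by
      refine le_antisymm ?_ (hre y (hmemJ y hy))
      simpa using hre _ (hmemJ _ (J.toSubmodule.neg_mem hy))
    intro y hy
    refine Complex.ext (key y hy) ?_
    simpa using key _ (J.toSubmodule.smul_mem Complex.I hy)
  have him : ∀ k : B, IsSelfAdjoint k → (g k).im = 0 := by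
    have key : ∀ k : B, IsSelfAdjoint k → (g k).im ≤ 0 := fun k hk => by
      simpa using hre (Complex.I • k) ⟨0, 0, k, le_rfl, J.toSubmodule.zero_mem, hk, by simp⟩
    intro k hk
    refine le_antisymm (key k hk) ?_
    simpa using key _ hk.neg
  have hpos : ∀ p : B, 0 ≤ p → 0 ≤ g p := fun p hp => by
    rw [Complex.nonneg_iff]
    exact ⟨hre p ⟨p, 0, 0, hp, J.toSubmodule.zero_mem, .zero _, by simp⟩,
      (him p (.of_nonneg hp)).symm⟩
  let f₀ : B →ₚ[ℂ] ℂ := .mk₀ g.toLinearMap hpos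
  have hf₀ : ∀ b, f₀ b = g b := fun _ => rfl
  have hgx : 0 < (g (star x * x)).re := by
    have := hu.trans hu0
    simpa using this
  have h1 : 0 ≤ g 1 := hpos 1 zero_le_one
  have h1ne : g 1 ≠ 0 := fun h => by
    have := eq_zero_of_apply_one_eq_zero (f := f₀) h (star x * x)
    rw [hf₀] at this
    simp [this] at hgx
  have h1r : g 1 = ((g 1).re : ℂ) := Complex.ext rfl (Complex.nonneg_iff.1 h1).2.symm
  have h1pos : 0 < (g 1).re := lt_of_le_of_ne (Complex.nonneg_iff.1 h1).1
    fun h => h1ne (by rw [h1r, ← h, Complex.ofReal_zero])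
  have hinv : 0 ≤ (g 1)⁻¹ := inv_nonneg.2 h1
  refine ⟨.mk₀ ((g 1)⁻¹ • g.toLinearMap) fun p hp => mul_nonneg hinv (hpos p hp),
    inv_mul_cancel₀ h1ne, fun y hy => ?_, ?_⟩
  · change (g 1)⁻¹ * g y = 0
    rw [hgJ y hy, mul_zero]
  · change 0 < ((g 1)⁻¹ * g (star x * x)).re
    rw [h1r, ← Complex.ofReal_inv, Complex.re_ofReal_mul]
    positivity

/-- A positive functional is pure if it dominates only its own multiples. -/
def IsPure (f : B →ₚ[ℂ] ℂ) : Prop :=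
  ∀ g : B →ₚ[ℂ] ℂ, (∀ b, 0 ≤ b → g b ≤ f b) → ∃ t : ℂ, ∀ b, g b = t * f b

/-- The states that kill a closed ideal, as a set of functions. -/
def statesKilling (J : ClosedIdeal B) : Set (B → ℂ) :=
  {g | ∃ f : B →ₚ[ℂ] ℂ, f 1 = 1 ∧ (∀ y ∈ J, f y = 0) ∧ ⇑f = g}

/-- Banach-Alaoglu by Tychonoff: the defining conditions are closed pointwise conditions inside the
product of the discs of radius $\|b\|$. -/
theorem isCompact_statesKilling (J : ClosedIdeal B) : IsCompact (statesKilling J) := by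
  have hK : IsCompact (Set.univ.pi fun b : B => Metric.closedBall (0 : ℂ) ‖b‖) :=
    isCompact_univ_pi fun b => isCompact_closedBall 0 ‖b‖
  have heq : statesKilling J = {g | (∀ a b, g (a + b) = g a + g b) ∧
      (∀ (c : ℂ) a, g (c • a) = c * g a) ∧ (∀ a, 0 ≤ a → 0 ≤ g a) ∧ g 1 = 1 ∧
      ∀ y ∈ J, g y = 0} := by
    ext g
    constructor
    · rintro ⟨f, h1, hJ, rfl⟩
      exact ⟨map_add f, map_smul f, fun a ha => f.map_nonneg ha, h1, hJ⟩
    · rintro ⟨hadd, hsmul, hpos, h1, hJ⟩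
      exact ⟨.mk₀ ⟨⟨g, hadd⟩, hsmul⟩ hpos, h1, hJ, rfl⟩
  refine hK.of_isClosed_subset ?_ ?_
  · rw [heq]
    simp only [Set.ofPred_and, Set.ofPred_forall]
    refine .inter (isClosed_iInter fun a => isClosed_iInter fun b => ?_)
      (.inter (isClosed_iInter fun c => isClosed_iInter fun a => ?_)
      (.inter (isClosed_iInter fun a => isClosed_iInter fun _ => ?_)
      (.inter ?_ (isClosed_iInter fun y => isClosed_iInter fun _ => ?_))))
    · exact isClosed_eq (by fun_prop) (by fun_prop)
    · exact isClosed_eq (by fun_prop) (by fun_prop)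
    · exact isClosed_le continuous_const (continuous_apply a)
    · exact isClosed_eq (by fun_prop) (by fun_prop)
    · exact isClosed_eq (by fun_prop) (by fun_prop)
  · rintro _ ⟨f, h1, -, rfl⟩ b -
    simpa [h1] using norm_apply_le f b

/-- If $g \le f$ and $t = g(1) \in (0,1)$, then $f = t\,(g/t) + (1-t)\,((f-g)/(1-t))$ is a convex
combination of states killing $J$, so $g = tf$. -/
theorem isPure_of_mem_extremePoints {J : ClosedIdeal B} {f : B →ₚ[ℂ] ℂ}
    (hf : ⇑f ∈ (statesKilling J).extremePoints ℝ) : IsPure f := by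
  obtain ⟨⟨f', h1, hJ, hff⟩, hext⟩ := hf
  obtain rfl : f' = f := DFunLike.coe_injective hff
  intro g hg
  have hg1 : 0 ≤ g 1 := g.map_nonneg zero_le_one
  have hg1' : g 1 ≤ 1 := (hg 1 zero_le_one).trans_eq h1
  have hr : g 1 = ((g 1).re : ℂ) := Complex.ext rfl (Complex.nonneg_iff.1 hg1).2.symm
  set t := (g 1).re
  have ht0 : 0 ≤ t := (Complex.nonneg_iff.1 hg1).1
  have ht1 : t ≤ 1 := by rw [hr] at hg1'; exact_mod_cast hg1'
  let k : B →ₚ[ℂ] ℂ := .mk₀ (f'.toLinearMap - g.toLinearMap) fun b hb => sub_nonneg.2 (hg b hb)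
  have hk : ∀ b, k b = f' b - g b := fun _ => rfl
  -- $0 \le g(y^*y) \le f(y^*y) = 0$, and Cauchy-Schwarz passes from $y^*y$ to $y$.
  have hgJ : ∀ y ∈ J, g y = 0 := fun y hy => by
    have h0 : g (star y * y) = 0 := le_antisymm
      ((hg _ (star_mul_self_nonneg y)).trans_eq (hJ _ (J.mul_mem_left _ hy)))
      (g.map_nonneg (star_mul_self_nonneg y))
    simpa [h0] using norm_apply_sq_le g y
  have hkJ : ∀ y ∈ J, k y = 0 := fun y hy => by rw [hk, hJ y hy, hgJ y hy, sub_zero]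
  have hk1 : k 1 = ((1 - t : ℝ) : ℂ) := by rw [hk, h1, hr]; push_cast; rfl
  rcases ht0.eq_or_lt with h | h
  · exact ⟨0, fun b => by
      rw [zero_mul, eq_zero_of_apply_one_eq_zero (by rw [hr, ← h, Complex.ofReal_zero])]⟩
  rcases ht1.eq_or_lt with h' | h'
  · refine ⟨1, fun b => ?_⟩
    have := eq_zero_of_apply_one_eq_zero (f := k) (by rw [hk1, h']; simp) b
    rw [hk, sub_eq_zero] at this
    rw [one_mul, this]
  have key : ∀ (q : B →ₚ[ℂ] ℂ) (s : ℝ), 0 < s → q 1 = s → (∀ y ∈ J, q y = 0) →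
      (s⁻¹ • ⇑q : B → ℂ) ∈ statesKilling J := by
    intro q s hs hq hqJ
    have hs' : (0 : ℂ) ≤ ((s⁻¹ : ℝ) : ℂ) := by exact_mod_cast (inv_pos.2 hs).le
    refine ⟨.mk₀ (((s⁻¹ : ℝ) : ℂ) • q.toLinearMap)
      fun p hp => mul_nonneg hs' (q.map_nonneg hp), ?_, fun y hy => ?_, ?_⟩
    · change ((s⁻¹ : ℝ) : ℂ) * q 1 = 1
      rw [hq, ← Complex.ofReal_mul, inv_mul_cancel₀ hs.ne', Complex.ofReal_one]
    · change ((s⁻¹ : ℝ) : ℂ) * q y = 0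
      rw [hqJ y hy, mul_zero]
    · funext b
      change ((s⁻¹ : ℝ) : ℂ) * q b = s⁻¹ • q b
      rw [Complex.real_smul]
  have h't : 0 < 1 - t := sub_pos.2 h'
  have heq := hext (key g t h hr hgJ) (key k (1 - t) h't hk1 hkJ)
    ⟨t, 1 - t, h, h't, by ring, by
      rw [smul_smul, smul_smul, mul_inv_cancel₀ h.ne', mul_inv_cancel₀ h't.ne', one_smul, one_smul]
      funext b
      simp [hk]⟩
  refine ⟨t, fun b => ?_⟩
  rw [← congrFun heq b, Pi.smul_apply, Complex.real_smul, ← mul_assoc, ← Complex.ofReal_mul,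
    mul_inv_cancel₀ h.ne', Complex.ofReal_one, one_mul]

/-- The states killing $J$ that maximise the value at $x^*x$ form a nonempty compact exposed face.
By Krein-Milman it has an extreme point, which is extreme among all states killing $J$. -/
theorem exists_isPure_state (J : ClosedIdeal B) {x : B} (hx : x ∉ J) :
    ∃ f : B →ₚ[ℂ] ℂ, IsPure f ∧ f 1 = 1 ∧ (∀ y ∈ J, f y = 0) ∧ f (star x * x) ≠ 0 := by
  obtain ⟨f₀, h1, hJ, hpos⟩ := exists_state_apply_pos J hx
  have hf₀ : ⇑f₀ ∈ statesKilling J := ⟨f₀, h1, hJ, rfl⟩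
  let l : (B → ℂ) →L[ℝ] ℝ := Complex.reCLM.comp (ContinuousLinearMap.proj (star x * x))
  have hc := isCompact_statesKilling J
  have hexp : IsExposed ℝ (statesKilling J)
      {g ∈ statesKilling J | ∀ w ∈ statesKilling J, l w ≤ l g} := fun _ => ⟨l, rfl⟩
  obtain ⟨z, hz, hzmax⟩ := hc.exists_isMaxOn ⟨_, hf₀⟩ l.continuous.continuousOn
  obtain ⟨g, hg⟩ := (hexp.isCompact hc).extremePoints_nonempty ⟨z, hz, hzmax⟩
  have hgext := hexp.isExtreme.extremePoints_subset_extremePoints hg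
  obtain ⟨f, hf1, hfJ, rfl⟩ := hgext.1
  refine ⟨f, isPure_of_mem_extremePoints hgext, hf1, hfJ, fun h => ?_⟩
  have : (f₀ (star x * x)).re ≤ (f (star x * x)).re := hg.1.2 _ hf₀
  rw [h, Complex.zero_re] at this
  exact this.not_gt hpos

end States

/-! ### Irreducibility of the GNS representation of a pure functional -/

section GNS
universe u
variable {B : Type u} [CStarAlgebra B] [PartialOrder B] [StarOrderedRing B] (f : B →ₚ[ℂ] ℂ)

/-- The canonical cyclic vector of the GNS representation. -/
noncomputable def gnsVector : f.GNS := (f.toPreGNS 1 : f.GNS)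

theorem gns_apply_gnsVector (b : B) : f.gnsStarAlgHom b (gnsVector f) = (f.toPreGNS b : f.GNS) := by
  simp [gnsVector, PositiveLinearMap.gnsStarAlgHom_apply]

theorem inner_gns_gnsVector (a b : B) :
    ⟪f.gnsStarAlgHom a (gnsVector f), f.gnsStarAlgHom b (gnsVector f)⟫_ℂ = f (star a * b) := by
  rw [gns_apply_gnsVector, gns_apply_gnsVector, UniformSpace.Completion.inner_coe,
    f.preGNS_inner_def, f.ofPreGNS_toPreGNS, f.ofPreGNS_toPreGNS]

theorem denseRange_gns_gnsVector : DenseRange fun b => f.gnsStarAlgHom b (gnsVector f) := by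
  simp only [gns_apply_gnsVector]
  exact UniformSpace.Completion.denseRange_coe.comp f.toPreGNS.surjective.denseRange
    (UniformSpace.Completion.continuous_coe _)

theorem ext_inner_gns {η ζ : f.GNS}
    (h : ∀ b, ⟪η, f.gnsStarAlgHom b (gnsVector f)⟫_ℂ = ⟪ζ, f.gnsStarAlgHom b (gnsVector f)⟫_ℂ) :
    η = ζ := by
  refine ext_inner_right ℂ fun v => ?_
  exact congrFun ((denseRange_gns_gnsVector f).equalizer (g := fun v => ⟪η, v⟫_ℂ)
    (h := fun v => ⟪ζ, v⟫_ℂ) (by fun_prop) (by fun_prop) (funext h)) v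

theorem ext_gns {T S : f.GNS →L[ℂ] f.GNS}
    (h : ∀ b, T (f.gnsStarAlgHom b (gnsVector f)) = S (f.gnsStarAlgHom b (gnsVector f))) :
    T = S :=
  DFunLike.coe_injective <|
    (denseRange_gns_gnsVector f).equalizer T.continuous S.continuous (funext h)

theorem inner_gns_apply (b : B) (η ζ : f.GNS) :
    ⟪f.gnsStarAlgHom b η, ζ⟫_ℂ = ⟪η, f.gnsStarAlgHom (star b) ζ⟫_ℂ := by
  rw [map_star, ContinuousLinearMap.star_eq_adjoint, ContinuousLinearMap.adjoint_inner_right]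

/-- The GNS representation of a pure functional is irreducible. -/
theorem IsPure.eq_bot_or_eq_top {f : B →ₚ[ℂ] ℂ} (hf : IsPure f) (K : Submodule ℂ f.GNS)
    (hK : IsClosed (K : Set f.GNS)) (hinv : ∀ b, ∀ η ∈ K, f.gnsStarAlgHom b η ∈ K) :
    K = ⊥ ∨ K = ⊤ := by
  have : CompleteSpace K := hK.completeSpace_coe
  set ξ := gnsVector f with hξ
  have hinv' : ∀ b, ∀ η ∈ Kᗮ, f.gnsStarAlgHom b η ∈ Kᗮ := fun b η hη => by
    rw [Submodule.mem_orthogonal'] at hη ⊢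
    intro ζ hζ
    rw [inner_gns_apply]
    exact hη _ (hinv _ _ hζ)
  set P := K.starProjection
  have hPmem : ∀ v, P v ∈ K := fun v => K.starProjection_apply_mem v
  have hcomm : ∀ b v, P (f.gnsStarAlgHom b v) = f.gnsStarAlgHom b (P v) := fun b v => by
    refine Submodule.eq_starProjection_of_mem_orthogonal (hinv b _ (hPmem v)) ?_
    rw [← map_sub]
    exact hinv' b _ (K.sub_starProjection_mem_orthogonal v)
  have hPsymm : ∀ v w, ⟪P v, w⟫_ℂ = ⟪v, P w⟫_ℂ := fun v w =>
    K.inner_starProjection_left_eq_right v w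
  have hPP : ∀ v, P (P v) = P v := fun v => Submodule.starProjection_eq_self_iff.2 (hPmem v)
  -- The projection $P$ onto $K$ commutes with the representation, so this functional sends $c^*c$
  -- to $\|P\pi(c)\xi\|^2 \le \|\pi(c)\xi\|^2 = f(c^*c)$, and purity applies.
  let g₀ : B →ₗ[ℂ] ℂ :=
    (innerSL ℂ (P ξ)).toLinearMap ∘ₗ (LinearMap.applyₗ ξ ∘ₗ ContinuousLinearMap.coeLM ℂ) ∘ₗ
      f.gnsStarAlgHom.toAlgHom.toLinearMap
  have hg₀ : ∀ b, g₀ b = ⟪P ξ, f.gnsStarAlgHom b ξ⟫_ℂ := fun _ => rfl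
  have hfb : ∀ b, f b = ⟪ξ, f.gnsStarAlgHom b ξ⟫_ℂ := fun b => by
    simpa using (inner_gns_gnsVector f 1 b).symm
  have hsq : ∀ c v, ⟪P v, f.gnsStarAlgHom (star c * c) v⟫_ℂ =
      ((‖P (f.gnsStarAlgHom c v)‖ ^ 2 : ℝ) : ℂ) := fun c v => by
    rw [map_mul, mul_apply_eq_comp, ← inner_gns_apply, ← hcomm]
    set w := f.gnsStarAlgHom c v
    rw [← hPP w, hPsymm, inner_self_eq_norm_sq_to_K, hPP, Complex.ofReal_pow]
    rfl
  have hsq' : ∀ c, f (star c * c) = ((‖f.gnsStarAlgHom c ξ‖ ^ 2 : ℝ) : ℂ) := fun c => by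
    rw [← inner_gns_gnsVector, inner_self_eq_norm_sq_to_K, Complex.ofReal_pow]
    rfl
  let g : B →ₚ[ℂ] ℂ := .mk₀ g₀ fun b hb => by
    obtain ⟨c, rfl⟩ := CStarAlgebra.nonneg_iff_eq_star_mul_self.1 hb
    rw [hg₀, hsq]
    exact Complex.zero_le_real.2 (sq_nonneg _)
  obtain ⟨t, ht⟩ := hf g fun b hb => by
    obtain ⟨c, rfl⟩ := CStarAlgebra.nonneg_iff_eq_star_mul_self.1 hb
    change g₀ _ ≤ _
    rw [hg₀, hsq, hsq', Complex.real_le_real]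
    gcongr
    exact K.norm_starProjection_apply_le _
  have hPξ : P ξ = star t • ξ := ext_inner_gns f fun b => by
    rw [← hξ, ← hg₀, inner_smul_left, ← hfb]
    rw [Complex.star_def, Complex.conj_conj]
    exact ht b
  -- $P\pi(b)\xi = \pi(b)P\xi$ is the same multiple of $\pi(b)\xi$ for all $b$, and these vectors
  -- are dense.
  have hP : P = star t • ContinuousLinearMap.id ℂ f.GNS := ext_gns f fun b => by
    rw [← hξ, hcomm, hPξ, map_smul]
    rfl
  have hPall : ∀ v, P v = star t • v := fun v => DFunLike.congr_fun hP v
  rcases eq_or_ne (star t) 0 with h0 | h0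
  · left
    rw [Submodule.eq_bot_iff]
    intro v hv
    rw [← Submodule.starProjection_eq_self_iff.2 hv]
    change P v = 0
    rw [hPall, h0, zero_smul]
  · right
    rw [Submodule.eq_top_iff']
    intro v
    have := hPmem v
    rw [hPall] at this
    exact (K.smul_mem_iff h0).1 this

end GNS

/-! ### Separating points from closed ideals by primitive ideals -/

section Primitive
universe u

theorem exists_isPrimitive_le_notMem {A : Type u} [NonUnitalCStarAlgebra A] (I : ClosedIdeal A)
    {x : A} (hx : x ∉ I) : ∃ P : ClosedIdeal A, P.IsPrimitive ∧ I ≤ P ∧ x ∉ P := by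
  let _ : PartialOrder (Unitization ℂ A) := CStarAlgebra.spectralOrder _
  have _ : StarOrderedRing (Unitization ℂ A) := CStarAlgebra.spectralOrderedRing _
  let J : ClosedIdeal (Unitization ℂ A) :=
    { I.toSubmodule.map (Unitization.inrHom ℂ ℂ A : A →ₗ[ℂ] Unitization ℂ A) with
      mul_mem_left' := by
        rintro a _ ⟨y, hy, rfl⟩
        refine ⟨a.fst • y + a.snd * y,
          I.toSubmodule.add_mem (I.toSubmodule.smul_mem _ hy) (I.mul_mem_left _ hy), ?_⟩
        ext <;> simp
      mul_mem_right' := by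
        rintro a _ ⟨y, hy, rfl⟩
        exact ⟨a.fst • y + y * a.snd,
          I.toSubmodule.add_mem (I.toSubmodule.smul_mem _ hy) (I.mul_mem_right _ hy),
          (inr_mul_eq_inr y a).symm⟩
      isClosed' := (Unitization.isometry_inr (𝕜 := ℂ) (A := A)).isClosedEmbedding.isClosedMap _
        I.isClosed }
  have hJ : ∀ {y : A}, (y : Unitization ℂ A) ∈ J ↔ y ∈ I := fun {y} =>
    ⟨fun ⟨z, hz, hzy⟩ => Unitization.inr_injective hzy ▸ hz, fun hy => ⟨y, hy, rfl⟩⟩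
  obtain ⟨f, hf, -, hfJ, hfx⟩ := exists_isPure_state J (mt hJ.1 hx)
  let π : A →⋆ₙₐ[ℂ] (f.GNS →L[ℂ] f.GNS) :=
    (f.gnsStarAlgHom : Unitization ℂ A →⋆ₙₐ[ℂ] (f.GNS →L[ℂ] f.GNS)).comp
      (Unitization.inrNonUnitalStarAlgHom ℂ A)
  have hπ : ∀ a, π a = f.gnsStarAlgHom (a : Unitization ℂ A) := fun _ => rfl
  have hπx : π x ≠ 0 := fun h => hfx <| by
    rw [← inner_gns_gnsVector, ← hπ, h]
    simp
  -- $\|\pi(y)\pi(b)\xi\|^2 = f((yb)^*(yb)) = 0$ for every $b$, since $J$ is an ideal.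
  have hπI : ∀ y ∈ I, π y = 0 := fun y hy => by
    refine ext_gns f fun b => ?_
    rw [zero_apply]
    rw [hπ, ← mul_apply_eq_comp, ← map_mul, ← inner_self_eq_zero (𝕜 := ℂ),
      inner_gns_gnsVector]
    exact hfJ _ (J.mul_mem_left _ (J.mul_mem_right _ (hJ.2 hy)))
  have hirr : IsIrreducibleRep π := by
    refine ⟨⟨x, hπx⟩, fun K hK hinv => hf.eq_bot_or_eq_top K hK fun b η hη => ?_⟩
    -- Scalars preserve every subspace, so invariance under $A$ gives invariance under the
    -- unitization.
    induction b using Unitization.ind with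
    | inl_add_inr r a =>
      rw [map_add, add_apply, ← hπ, ← Unitization.algebraMap_eq_inl,
        AlgHomClass.commutes]
      exact K.add_mem (K.smul_mem r hη) (hinv a η hη)
  let P : ClosedIdeal A :=
    { LinearMap.ker (π : A →ₗ[ℂ] (f.GNS →L[ℂ] f.GNS)) with
      mul_mem_left' := fun a y (hy : π y = 0) => show π (a * y) = 0 by rw [map_mul, hy, mul_zero]
      mul_mem_right' := fun a y (hy : π y = 0) => show π (y * a) = 0 by rw [map_mul, hy, zero_mul]
      isClosed' := isClosed_singleton.preimage (f := π) (AddMonoidHomClass.continuous_of_bound π 1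
        (by simpa only [one_mul] using NonUnitalStarAlgHom.norm_apply_le π)) }
  exact ⟨P, ⟨f.GNS, inferInstance, inferInstance, inferInstance, π, hirr, fun _ => Iff.rfl⟩,
    hπI, hπx⟩

end Primitive
-- Open sets of the primitive ideal space, and the five claims
section PrimitiveIdealSpace
universe u v
open ClosedIdeal

variable {A : Type u} [NonUnitalCStarAlgebra A]

/-- The open subset of `Prim A` determined by a closed ideal: the complement of its hull. -/
def Prim.coHull (I : ClosedIdeal A) : Opens (Prim A) where
  carrier := (Prim.hull I)ᶜ
  is_open' := ⟨I, (compl_compl _).symm⟩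

theorem Prim.notMem_coHull {I : ClosedIdeal A} {P : Prim A} : P ∉ Prim.coHull I ↔ I ≤ P.1 :=
  not_not

theorem Prim.exists_eq_coHull (G : Opens (Prim A)) : ∃ I : ClosedIdeal A, G = Prim.coHull I := by
  obtain ⟨I, hI⟩ : (G : Set (Prim A))ᶜ ∈ Set.range Prim.hull := G.isOpen
  exact ⟨I, Opens.ext (by rw [← compl_compl (G : Set (Prim A)), ← hI]; rfl)⟩

theorem primAction_coHull (I : ClosedIdeal A) : primAction A (Prim.coHull I) = I := by
  refine le_antisymm (fun x hx => ?_) (le_sInf ?_)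
  · by_contra hxI
    obtain ⟨P, hP, hIP, hxP⟩ := exists_isPrimitive_le_notMem I hxI
    exact hxP (mem_sInf.1 hx P ⟨⟨P, hP⟩, Prim.notMem_coHull.2 hIP, rfl⟩)
  · rintro _ ⟨P, hP, rfl⟩
    exact Prim.notMem_coHull.1 hP

theorem coHull_primAction (G : Opens (Prim A)) : Prim.coHull (primAction A G) = G := by
  obtain ⟨I, rfl⟩ := Prim.exists_eq_coHull G
  rw [primAction_coHull]

variable (A) in
/-- Open subsets of `Prim A` correspond to closed ideals of `A`. -/
def primOrderIso : Opens (Prim A) ≃o ClosedIdeal A where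
  toFun := primAction A
  invFun := Prim.coHull
  left_inv := coHull_primAction
  right_inv := primAction_coHull
  map_rel_iff' {G H} := by
    refine ⟨fun h => ?_, fun h => (primAction A).monotone h⟩
    rw [← coHull_primAction G, ← coHull_primAction H]
    exact fun P hP hP' => hP (le_trans h hP')

theorem primOrderIso_apply (G : Opens (Prim A)) : primOrderIso A G = primAction A G := rfl

variable {D : Type u} {E : Type v} [NonUnitalCStarAlgebra D] [NonUnitalCStarAlgebra E]

theorem mem_pullbackAction {φ : D →⋆ₙₐ[ℂ] E} {d : D} {U : Opens (Prim E)} :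
    d ∈ pullbackAction φ U ↔ φ d ∈ primAction E U := Iff.rfl

/-- The left side of the inequality does not depend on $U$, so infima and least open sets can be
read off. -/
theorem mem_primAction_iff {e : E} {U : Opens (Prim E)} :
    e ∈ primAction E U ↔ (primOrderIso E).symm (gen E e) ≤ U := by
  rw [(primOrderIso E).symm_apply_le, primOrderIso_apply, gen_le_iff]

theorem pullbackAction_sInf (φ : D →⋆ₙₐ[ℂ] E) (S : Set (Opens (Prim E))) :
    pullbackAction φ (sInf S) = sInf (pullbackAction φ '' S) := by
  refine SetLike.ext fun d => ?_
  simp only [mem_pullbackAction, mem_primAction_iff, mem_sInf, Set.forall_mem_image, le_sInf_iff]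

/-- A directed family with finite range attains a greatest value, and a monotone map preserves it.
-/
theorem map_iSup_of_directed_of_finite {ι α β : Type*} [CompleteLattice α] [CompleteLattice β]
    [Finite α] [Nonempty ι] (f : α →o β) {G : ι → α} (hG : Directed (· ≤ ·) G) :
    f (⨆ i, G i) = ⨆ i, f (G i) := by
  obtain ⟨i, hi⟩ : ∃ i, ∀ j, G j ≤ G i := by
    obtain ⟨_, ⟨i, rfl⟩, hi⟩ := (Set.toFinite (Set.range G)).exists_maximal
      (Set.range_nonempty G)
    refine ⟨i, fun j => ?_⟩
    obtain ⟨k, hik, hjk⟩ := hG i j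
    exact hjk.trans (hi ⟨k, rfl⟩ hik)
  rw [le_antisymm (iSup_le hi) (le_iSup G i)]
  exact le_antisymm (le_iSup (fun i => f (G i)) i) (iSup_le fun j => f.monotone (hi j))

theorem isSmallestSupport_pullbackAction_iff {φ : D →⋆ₙₐ[ℂ] E} {d : D} {U : Opens (Prim E)} :
    IsSmallestSupport (pullbackAction φ) d U ↔ U = (primOrderIso E).symm (gen E (φ d)) := by
  have h : IsLeast {V | d ∈ pullbackAction φ V} ((primOrderIso E).symm (gen E (φ d))) :=
    ⟨mem_primAction_iff.2 le_rfl, fun V hV => mem_primAction_iff.1 hV⟩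
  exact ⟨fun hU => hU.unique h, fun hU => hU ▸ h⟩

/-- Since $E(U_d) = \mathrm{Ideal}(\phi(d))$, fullness of $\psi(d)$ there is equality of the two
generated ideals. -/
theorem gen_eq_iff_isEquivariant_and_isXFull (φ ψ : D →⋆ₙₐ[ℂ] E) :
    (∀ a : D, gen E (ψ a) = gen E (φ a)) ↔
      IsEquivariant (pullbackAction φ) (primAction E) ψ ∧
        IsXFull (pullbackAction φ) (primAction E) ψ := by
  constructor
  · intro h
    refine ⟨?_, fun d => ⟨_, isSmallestSupport_pullbackAction_iff.2 rfl, ?_⟩⟩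
    · rintro U _ ⟨d, hd, rfl⟩
      rw [SetLike.mem_coe, ← gen_le_iff, h, gen_le_iff]
      exact hd
    · rw [isFullIn_iff, h, ← primOrderIso_apply, OrderIso.apply_symm_apply]
  · rintro ⟨-, h⟩ a
    obtain ⟨U, hU, hf⟩ := h a
    rw [isSmallestSupport_pullbackAction_iff.1 hU, isFullIn_iff, ← primOrderIso_apply,
      OrderIso.apply_symm_apply] at hf
    exact hf

end PrimitiveIdealSpace

end CStarX

theorem mainTheorem11 {D : Type*} {E : Type*}
    [NonUnitalCStarAlgebra D] [NonUnitalCStarAlgebra E] (φ : D →⋆ₙₐ[ℂ] E) :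
    -- (1)
    (∃ e : TopologicalSpace.Opens (CStarX.Prim E) ≃o CStarX.ClosedIdeal E,
      ∀ G, e G = CStarX.primAction E G) ∧
    -- (2)
    (∀ S : Set (TopologicalSpace.Opens (CStarX.Prim E)),
      CStarX.pullbackAction φ (sInf S) = sInf (CStarX.pullbackAction φ '' S)) ∧
    (Finite (TopologicalSpace.Opens (CStarX.Prim E)) →
      ∀ (I : Type*) [Preorder I] [IsDirectedOrder I] [Nonempty I]
        (G : I → TopologicalSpace.Opens (CStarX.Prim E)), Monotone G →
        CStarX.pullbackAction φ (⨆ i, G i) = ⨆ i, CStarX.pullbackAction φ (G i)) ∧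
    -- (3)
    (∀ d : D, ∃ U : TopologicalSpace.Opens (CStarX.Prim E),
      CStarX.IsSmallestSupport (CStarX.pullbackAction φ) d U) ∧
    -- (4)
    (CStarX.IsEquivariant (CStarX.pullbackAction φ) (CStarX.primAction E) φ ∧
      CStarX.IsXFull (CStarX.pullbackAction φ) (CStarX.primAction E) φ) ∧
    -- (5)
    (∀ ψ : D →⋆ₙₐ[ℂ] E,
      (∀ a : D, CStarX.ClosedIdeal.gen E (ψ a) = CStarX.ClosedIdeal.gen E (φ a)) ↔
        (CStarX.IsEquivariant (CStarX.pullbackAction φ) (CStarX.primAction E) ψ ∧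
          CStarX.IsXFull (CStarX.pullbackAction φ) (CStarX.primAction E) ψ)) :=
  ⟨⟨CStarX.primOrderIso E, CStarX.primOrderIso_apply⟩, CStarX.pullbackAction_sInf φ,
    fun _ _ _ _ _ _ hG => CStarX.map_iSup_of_directed_of_finite _ hG.directed_le,
    fun _ => ⟨_, CStarX.isSmallestSupport_pullbackAction_iff.2 rfl⟩,
    -- Claim 4 is the case $\psi = \phi$ of claim 5.
    (CStarX.gen_eq_iff_isEquivariant_and_isXFull φ φ).1 fun _ => rfl,
    CStarX.gen_eq_iff_isEquivariant_and_isXFull φ⟩
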